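/- Let $\widetilde A=\{a,a^{-1}\}$. For a word $w=x_1\cdots x_n\in\widetilde A^*$ put $w^{-1}=x_n^{-1}\cdots x_1^{-1}$, where $(a^{-1})^{-1}=a$. Let $F$ be the monogenic free inverse monoid, i.e. the quotient of the free monoid $\widetilde A^*$ by the congruence generated by all pairs $(ww^{-1}w,\,w)$ and $(uu^{-1}vv^{-1},\,vv^{-1}uu^{-1})$ with $u,v,w\in\widetilde A^*$, and let $\theta:\widetilde A^*\to F$ be the canonical homomorphism. A subset of a monoid is called rational if it can be obtained from finite subsets by finitely many applications of union $X\cup Y$, product $XY$ and star $X^*=\bigcup_{n\ge 0}X^n$. Theorem. A submonoid $M$ of $F$ is a rational subset of $F$ if and only if it is finitely generated (as a monoid). Moreover, a finite generating set of a rational submonoid can be computed: there is a computable function which, on input a finite (nondeterministic) automaton $\mathcal A$ over $\widetilde A$ such that $L(\mathcal A)\theta$ is a submonoid $M$ of $F$, outputs a finite list of words over $\widetilde A$ whose images under $\theta$ generate $M$ as a monoid. -/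

import Mathlib

open scoped Pointwise

/-- The formal inverse of a word over `α ∪ α⁻¹`. The letter `(x, true)` stands for `x` and
`(x, false)` for `x⁻¹`; the word is reversed and every letter is inverted. -/
def wordInv {α : Type*} (w : FreeMonoid (α × Bool)) : FreeMonoid (α × Bool) :=
  FreeMonoid.ofList ((w.toList.map fun x => (x.1, !x.2)).reverse)

/-- The generating pairs of the Wagner congruence: `(w w⁻¹ w, w)` and
`(u u⁻¹ v v⁻¹, v v⁻¹ u u⁻¹)`. -/
inductive WagnerRel (α : Type*) : FreeMonoid (α × Bool) → FreeMonoid (α × Bool) → Prop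
  | regular (w : FreeMonoid (α × Bool)) : WagnerRel α (w * wordInv w * w) w
  | comm (u v : FreeMonoid (α × Bool)) :
      WagnerRel α (u * wordInv u * (v * wordInv v)) (v * wordInv v * (u * wordInv u))

/-- The Wagner congruence on the free monoid over `α ∪ α⁻¹`. -/
def wagnerCon (α : Type*) : Con (FreeMonoid (α × Bool)) := conGen (WagnerRel α)

/-- The free inverse monoid on `α`. -/
abbrev FreeInverseMonoid (α : Type*) : Type _ := (wagnerCon α).Quotient

/-- The monogenic free inverse monoid `F`. -/
abbrev MonogenicFIM : Type := FreeInverseMonoid Unit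

/-- The element of the free inverse monoid represented by a word over `α ∪ α⁻¹`. -/
def FreeInverseMonoid.ofWord {α : Type*} (w : List (α × Bool)) : FreeInverseMonoid α :=
  (wagnerCon α).mk' (FreeMonoid.ofList w)

/-- Rational subsets of a monoid: obtained from finite subsets by finitely many applications of
union, product and star, where `X* = ⋃ n, X ^ n` (with `X ^ 0 = {1}`). -/
inductive IsRationalSubset {M : Type*} [Monoid M] : Set M → Prop
  | finite (s : Set M) (hs : s.Finite) : IsRationalSubset s
  | union (s t : Set M) (hs : IsRationalSubset s) (ht : IsRationalSubset t) :
      IsRationalSubset (s ∪ t)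
  | mul (s t : Set M) (hs : IsRationalSubset s) (ht : IsRationalSubset t) :
      IsRationalSubset (s * t)
  | star (s : Set M) (hs : IsRationalSubset s) : IsRationalSubset (⋃ n : ℕ, s ^ n)

/-- A finite automaton over `α ∪ α⁻¹`, presented by the list of its initial vertices, the list of
its terminal vertices and the list of its edges; the vertices are the natural numbers that occur
in these lists. -/
abbrev FiniteAutomaton (α : Type*) : Type _ :=
  List ℕ × List ℕ × List (ℕ × (α × Bool) × ℕ)

/-- The nondeterministic automaton presented by the three lists. -/
def FiniteAutomaton.toNFA {α : Type*} (A : FiniteAutomaton α) : NFA (α × Bool) ℕ where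
  start := {q | q ∈ A.1}
  accept := {q | q ∈ A.2.1}
  step p x := {q | (p, x, q) ∈ A.2.2}

/-- The rational subset of the free inverse monoid presented by a finite automaton: the image of
its language. -/
def FiniteAutomaton.subset {α : Type*} (A : FiniteAutomaton α) : Set (FreeInverseMonoid α) :=
  FreeInverseMonoid.ofWord '' A.toNFA.accepts

/-!
A word over `{a, a⁻¹}` describes a walk on `ℤ`. Its profile, consisting of the least and the
greatest integer visited and of the endpoint, determines the element of the monogenic free inverse
monoid that the word represents (`FreeInverseMonoid.ofWord_eq_of_profile_eq`): in any monoid in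
which the powers of `a` and `a⁻¹` are mutually inverse with commuting idempotents, a word can be
brought into the normal form `a⁻ᵐ aᵐ aⁿ a⁻ⁿ aᵏ`, letter by letter.

The heart of the proof is that the words accepted by an automaton with at most `N` states have the
profiles of products of accepted words of length at most an explicit bound
(`NFA.Supported.exists_short_factorization`). If an automaton describes a submonoid, its short
accepted words therefore generate it, and they can be listed. Every rational subset is the image of
a regular language (`FreeInverseMonoid.exists_isRegular_image_eq`), so this also shows that
rational submonoids are finitely generated; the converse is immediate.

For the factorization, a long accepted word `w` has to be written, up to its profile, as a product
of smaller accepted words, where words are compared first by the length of the interval visited and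
then by their own length (`NFA.Supported.factors`). If the interval is short, two prefixes of `w`
have the same profile and lead to the same state, and the factor between them can be deleted. If the
interval is long, the basic observation is that every factor of `w` becomes accepted once it is
extended on either side by a word of length at most `N`. So `w` may be cut in two far from the ends
of the interval, and both parts be completed to accepted words; it remains to correct the
displacement caused by the completions with a product of accepted words of bounded profile.

* If `w` contains both a climb and a descent by `2 * N + 1`, completing these gives accepted words
  `g` and `h` of small positive and small negative displacement. The completions `z`, `z'` at the
  cut form an accepted word `y = z z'`. If the displacements of `y` and `h` are `ε > 0` and `-r`,
  then `y ^ (r - 1) h ^ ε` has displacement `-ε`; if `ε < 0`, use `g` instead.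
* If `w` contains no such descent, then `w` climbs almost monotonically, and a word `g` of small
  displacement `p > 0` exists. Among more than `N` levels in arithmetic progression with a
  difference divisible by `p`, two are passed in the same state. The part of `w` between them, of
  displacement `p * c`, is replaced by `y ^ (p - 1) g ^ (c - ε)`, whose displacement is
  `p * c - ε`.
* If `w` contains no such climb, reflect `ℤ`.
-/

/-! ### The walk of a word on the integers -/

namespace Walk

variable {α : Type*} (f : α → ℤ)

/-- The endpoint of the walk on `ℤ` that starts at `0` and reads a word, each letter `x` being
a step by `f x`. -/
def disp : List α → ℤ
  | [] => 0
  | x :: w => f x + disp w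

/-- The least integer visited by the walk of a word. -/
def lo : List α → ℤ
  | [] => 0
  | x :: w => min 0 (f x + lo w)

/-- The greatest integer visited by the walk of a word. -/
def hi : List α → ℤ
  | [] => 0
  | x :: w => max 0 (f x + hi w)

/-- The least and the greatest integer visited by the walk of a word, and its endpoint. -/
def profile (w : List α) : ℤ × ℤ × ℤ := (lo f w, hi f w, disp f w)

/-- The length of the interval visited by the walk of a word. -/
def ext (w : List α) : ℕ := (hi f w - lo f w).toNat

@[simp] lemma disp_nil : disp f [] = 0 := rfl
@[simp] lemma lo_nil : lo f [] = 0 := rfl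
@[simp] lemma hi_nil : hi f [] = 0 := rfl

lemma lo_nonpos (w : List α) : lo f w ≤ 0 := by
  cases w <;> simp [lo]

lemma hi_nonneg (w : List α) : 0 ≤ hi f w := by
  cases w <;> simp [hi]

lemma disp_append (u v : List α) : disp f (u ++ v) = disp f u + disp f v := by
  induction u with
  | nil => simp
  | cons x u ih => simp only [List.cons_append, disp, ih]; ring

lemma lo_append (u v : List α) : lo f (u ++ v) = min (lo f u) (disp f u + lo f v) := by
  induction u with
  | nil => have := lo_nonpos f v; simp [this]
  | cons x u ih => simp only [List.cons_append, disp, lo, ih]; omega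

lemma hi_append (u v : List α) : hi f (u ++ v) = max (hi f u) (disp f u + hi f v) := by
  induction u with
  | nil => have := hi_nonneg f v; simp [this]
  | cons x u ih => simp only [List.cons_append, disp, hi, ih]; omega

lemma lo_le_disp (w : List α) : lo f w ≤ disp f w := by
  induction w with
  | nil => simp
  | cons x u ih => simp only [disp, lo]; omega

lemma disp_le_hi (w : List α) : disp f w ≤ hi f w := by
  induction w with
  | nil => simp
  | cons x u ih => simp only [disp, hi]; omega

lemma cast_ext (w : List α) : (ext f w : ℤ) = hi f w - lo f w := by
  have := lo_nonpos f w
  have := hi_nonneg f w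
  rw [ext]; omega

lemma disp_neg (w : List α) : disp (-f) w = -disp f w := by
  induction w with
  | nil => simp
  | cons x u ih => simp only [disp, ih, Pi.neg_apply]; ring

lemma lo_neg (w : List α) : lo (-f) w = -hi f w := by
  induction w with
  | nil => simp
  | cons x u ih => simp only [lo, hi, ih, Pi.neg_apply]; omega

lemma hi_neg (w : List α) : hi (-f) w = -lo f w := by
  induction w with
  | nil => simp
  | cons x u ih => simp only [lo, hi, ih, Pi.neg_apply]; omega

lemma ext_neg (w : List α) : ext (-f) w = ext f w := by
  simp only [ext, lo_neg, hi_neg]; congr 1; ring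

lemma profile_eq_iff {u v : List α} :
    profile f u = profile f v ↔ lo f u = lo f v ∧ hi f u = hi f v ∧ disp f u = disp f v := by
  simp [profile]

lemma profile_neg_eq_iff {u v : List α} :
    profile (-f) u = profile (-f) v ↔ profile f u = profile f v := by
  simp only [profile_eq_iff, lo_neg, hi_neg, disp_neg]; omega

lemma profile_append_congr {u u' : List α} (h : profile f u = profile f u') (v : List α) :
    profile f (u ++ v) = profile f (u' ++ v) := by
  rw [profile_eq_iff] at h ⊢
  obtain ⟨h1, h2, h3⟩ := h
  simp only [lo_append, hi_append, disp_append, h1, h2, h3, and_self]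

lemma exists_append_disp_eq_lo (w : List α) : ∃ u v, w = u ++ v ∧ disp f u = lo f w := by
  induction w with
  | nil => exact ⟨[], [], rfl, rfl⟩
  | cons x w ih =>
    obtain ⟨u, v, rfl, h⟩ := ih
    by_cases hx : 0 ≤ f x + lo f (u ++ v)
    · exact ⟨[], _, rfl, by simp [lo, hx]⟩
    · exact ⟨x :: u, v, rfl, by simp only [lo, disp, h]; omega⟩

lemma exists_append_disp_eq_hi (w : List α) : ∃ u v, w = u ++ v ∧ disp f u = hi f w := by
  obtain ⟨u, v, h, h'⟩ := exists_append_disp_eq_lo (-f) w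
  exact ⟨u, v, h, by rw [lo_neg, disp_neg] at h'; omega⟩

/-- Walks of the words in a list that stay in `[-c, c]` stay together in an interval whose radius
is `c` times the length of the list. -/
lemma flatten_bound {c : ℤ} (ws : List (List α))
    (h : ∀ v ∈ ws, -c ≤ lo f v ∧ hi f v ≤ c) :
    -(ws.length * c) ≤ lo f ws.flatten ∧ hi f ws.flatten ≤ ws.length * c := by
  induction ws with
  | nil => simp
  | cons v ws ih =>
    have h1 := ih fun u hu => h u (List.mem_cons_of_mem _ hu)
    have h2 := h v List.mem_cons_self
    have h3 := lo_le_disp f v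
    have h4 := disp_le_hi f v
    have h5 := lo_nonpos f ws.flatten
    have h6 := hi_nonneg f ws.flatten
    have h7 : ((v :: ws).length : ℤ) * c = ws.length * c + c := by
      push_cast [List.length_cons]; ring
    have h8 := lo_nonpos f v
    have h9 := hi_nonneg f v
    rw [List.flatten_cons, lo_append, hi_append, h7]
    omega

lemma disp_flatten_replicate (n : ℕ) (v : List α) :
    disp f (List.replicate n v).flatten = n * disp f v := by
  induction n with
  | zero => simp
  | succ n ih => rw [List.replicate_succ, List.flatten_cons, disp_append, ih]; push_cast; ring

/-- A power of a word with nonnegative displacement descends no further than the word, and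
overshoots its endpoint by no more than the height of the word. -/
lemma flatten_replicate_bound (n : ℕ) (v : List α) (h : 0 ≤ disp f v) :
    lo f v ≤ lo f (List.replicate n v).flatten ∧
      hi f (List.replicate n v).flatten ≤ n * disp f v + hi f v := by
  induction n with
  | zero => simpa using ⟨lo_nonpos f v, hi_nonneg f v⟩
  | succ n ih =>
    rw [List.replicate_succ, List.flatten_cons, lo_append, hi_append]
    have h1 : ((n + 1 : ℕ) : ℤ) * disp f v = n * disp f v + disp f v := by push_cast; ring
    have h2 : 0 ≤ (n : ℤ) * disp f v := by positivity
    rw [h1]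
    omega


variable {f}

lemma neg_length_le_lo (hf : ∀ x, |f x| ≤ 1) (w : List α) : -(w.length : ℤ) ≤ lo f w := by
  induction w with
  | nil => simp
  | cons x u ih =>
    have := abs_le.1 (hf x)
    simp only [lo, List.length_cons]; push_cast; omega

lemma hi_le_length (hf : ∀ x, |f x| ≤ 1) (w : List α) : hi f w ≤ w.length := by
  have := neg_length_le_lo (f := -f) (by simpa using hf) w
  rw [lo_neg] at this; omega

/-- Walks have no jumps: every level between the heights of two prefixes of a word is the height
of a prefix of intermediate length. -/
lemma exists_take_disp_eq (hf : ∀ x, |f x| ≤ 1) (w : List α) (c : ℤ) {i j : ℕ} (hij : i ≤ j)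
    (h : disp f (w.take i) ≤ c ∧ c ≤ disp f (w.take j) ∨
      disp f (w.take j) ≤ c ∧ c ≤ disp f (w.take i)) :
    ∃ t, i ≤ t ∧ t ≤ j ∧ disp f (w.take t) = c := by
  induction j, hij using Nat.le_induction with
  | base => exact ⟨i, le_rfl, le_rfl, by omega⟩
  | succ j hij ih =>
    have key : |disp f (w.take (j + 1)) - disp f (w.take j)| ≤ 1 := by
      rw [List.take_add_one, disp_append]
      cases h : w[j]? with
      | none => simp
      | some x => simpa [disp] using hf x
    rw [abs_le] at key
    by_cases hc : disp f (w.take (j + 1)) = c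
    · exact ⟨j + 1, by omega, le_rfl, hc⟩
    · obtain ⟨t, h1, h2, h3⟩ := ih (by omega)
      exact ⟨t, h1, by omega, h3⟩

lemma abs_disp_take_sub_le (hf : ∀ x, |f x| ≤ 1) (w : List α) {i j : ℕ} (hij : i ≤ j) :
    |disp f (w.take j) - disp f (w.take i)| ≤ (j - i : ℕ) := by
  induction j, hij using Nat.le_induction with
  | base => simp
  | succ j hij ih =>
    have key : |disp f (w.take (j + 1)) - disp f (w.take j)| ≤ 1 := by
      rw [List.take_add_one, disp_append]
      cases h : w[j]? with
      | none => simp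
      | some x => simpa [disp] using hf x
    rw [abs_le] at key ih ⊢
    omega

/-- A shortest factor of displacement at least `L > 0` climbs by exactly `L` and stays between the
levels of its endpoints. -/
lemma exists_climb (hf : ∀ x, |f x| ≤ 1) {L : ℤ} (hL : 0 < L) {w v : List α} (hv : v <:+: w)
    (h : L ≤ disp f v) :
    ∃ b, b <:+: w ∧ disp f b = L ∧ 0 ≤ lo f b ∧ hi f b ≤ L := by
  induction hn : v.length using Nat.strong_induction_on generalizing v with
  | _ n ih =>
  by_cases hshort : ∃ b, b <:+: v ∧ b.length < v.length ∧ L ≤ disp f b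
  · obtain ⟨b, hb, hlt, hbL⟩ := hshort
    exact ih _ (hn ▸ hlt) (hb.trans hv) hbL rfl
  push Not at hshort
  -- No shorter factor climbs by `L`, so no prefix of `v` is below `0` or above `L`.
  have hpre : ∀ a b, v = a ++ b → 0 ≤ disp f a ∧ (b ≠ [] → disp f a < L) := by
    rintro a b rfl
    constructor
    · by_contra hneg
      have hne : a ≠ [] := by rintro rfl; simp at hneg
      have := hshort b ⟨a, [], by simp⟩
        (by simpa using List.length_pos_iff.2 hne)
      rw [disp_append] at h
      omega
    · intro hne
      exact hshort a ⟨[], b, by simp⟩ (by simpa using List.length_pos_iff.2 hne)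
  have hdisp : disp f v ≤ L := by
    rcases List.eq_nil_or_concat v with rfl | ⟨a, x, rfl⟩
    · simpa using hL.le
    · have h1 := (hpre a [x] (by simp)).2 (by simp)
      have h2 := abs_le.1 (hf x)
      rw [List.concat_eq_append, disp_append]
      simp only [disp]
      omega
  refine ⟨v, hv, by omega, ?_, ?_⟩
  · obtain ⟨a, b, hab, ha⟩ := exists_append_disp_eq_lo f v
    exact ha ▸ (hpre a b hab).1
  · obtain ⟨a, b, hab, ha⟩ := exists_append_disp_eq_hi f v
    rcases eq_or_ne b [] with rfl | hb
    · rw [List.append_nil] at hab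
      subst hab; omega
    · have := (hpre a b hab).2 hb
      omega

end Walk

/-! ### Cutting and completing the runs of an automaton -/

namespace NFA

variable {α σ : Type*} {M : NFA α σ} {S : Finset σ} {r s : σ} {u v w : List α}

lemma mem_evalFrom_append {I : Set σ} :
    s ∈ M.evalFrom I (u ++ v) ↔ ∃ r ∈ M.evalFrom I u, s ∈ M.evalFrom {r} v := by
  rw [evalFrom_append, mem_evalFrom_iff_exists]

lemma append_mem_accepts :
    u ++ v ∈ M.accepts ↔ ∃ r ∈ M.eval u, v ∈ M.acceptsFrom {r} := by
  simp only [mem_accepts, mem_acceptsFrom, mem_evalFrom_append, eval]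
  constructor
  · rintro ⟨q, hq, r, hr, h⟩; exact ⟨r, hr, q, hq, h⟩
  · rintro ⟨r, hr, q, hq, h⟩; exact ⟨q, hq, r, hr, h⟩

lemma append_mem_acceptsFrom_singleton :
    u ++ v ∈ M.acceptsFrom {r} ↔ ∃ s ∈ M.evalFrom {r} u, v ∈ M.acceptsFrom {s} := by
  simp only [mem_acceptsFrom, mem_evalFrom_append]
  constructor
  · rintro ⟨q, hq, r, hr, h⟩; exact ⟨r, hr, q, hq, h⟩
  · rintro ⟨r, hr, q, hq, h⟩; exact ⟨q, hq, r, hr, h⟩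

/-- The finite set `S` contains the initial states and the targets of all transitions. -/
structure Supported (M : NFA α σ) (S : Finset σ) : Prop where
  start : M.start ⊆ S
  step : ∀ p a, M.step p a ⊆ S

lemma Supported.evalFrom (hS : M.Supported S) {I : Set σ} (hI : I ⊆ S) (w : List α) :
    M.evalFrom I w ⊆ S := by
  induction w generalizing I with
  | nil => simpa
  | cons x w ih =>
    rw [evalFrom_cons]
    refine ih fun q hq => ?_
    obtain ⟨p, -, h⟩ := M.mem_stepSet.1 hq
    exact hS.step p x h

lemma Supported.eval (hS : M.Supported S) (w : List α) : M.eval w ⊆ S :=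
  hS.evalFrom hS.start w

/-- Pumping with an invariant: a long run has a nonempty factor at whose ends both the state and
the value of a given function `g` of the word read so far agree; the factor can be deleted. -/
lemma Supported.exists_shortcut (hS : M.Supported S) {I : Set σ} (hI : I ⊆ S)
    (h : s ∈ M.evalFrom I w) {X : Type*} (g : List α → X) (T : Finset X)
    (hT : ∀ u v, w = u ++ v → g u ∈ T) (hlen : S.card * T.card ≤ w.length) :
    ∃ u v t, w = u ++ v ++ t ∧ v ≠ [] ∧ s ∈ M.evalFrom I (u ++ t) ∧ g u = g (u ++ v) := by
  have hsplit (i : ℕ) : ∃ r ∈ M.evalFrom I (w.take i), s ∈ M.evalFrom {r} (w.drop i) := by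
    rwa [← mem_evalFrom_append, List.take_append_drop]
  choose r hr hr' using hsplit
  obtain ⟨i, hi, j, hj, hij, heq⟩ := Finset.exists_ne_map_eq_of_card_lt_of_maps_to
    (s := Finset.range (w.length + 1)) (t := S ×ˢ T) (f := fun i => (r i, g (w.take i)))
    (by rw [Finset.card_product, Finset.card_range]; omega)
    (fun i _ => Finset.mem_coe.2 <| Finset.mem_product.2
      ⟨hS.evalFrom hI _ (hr i), hT _ _ (List.take_append_drop i w).symm⟩)
  wlog hlt : i < j generalizing i j
  · exact this j hj i hi hij.symm heq.symm (by omega)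
  simp only [Finset.mem_range, Prod.mk.injEq] at hi hj heq
  have hsplit : w.take i ++ (w.take j).drop i = w.take j := by
    conv_rhs => rw [← List.take_append_drop i (w.take j), List.take_take, min_eq_left hlt.le]
  refine ⟨w.take i, (w.take j).drop i, w.drop j, ?_, ?_, ?_, ?_⟩
  · rw [hsplit, List.take_append_drop]
  · intro h0
    have := congrArg List.length h0
    simp at this
    omega
  · exact mem_evalFrom_append.2 ⟨r i, hr i, heq.1 ▸ hr' j⟩
  · rw [hsplit, heq.2]

lemma Supported.exists_short_run (hS : M.Supported S) {I : Set σ} (hI : I ⊆ S)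
    (h : s ∈ M.evalFrom I w) : ∃ z, s ∈ M.evalFrom I z ∧ z.length ≤ S.card := by
  induction hn : w.length using Nat.strong_induction_on generalizing w with
  | _ n ih =>
  by_cases hw : w.length ≤ S.card
  · exact ⟨w, h, hw⟩
  obtain ⟨u, v, t, rfl, hv, hrun, -⟩ := hS.exists_shortcut hI h (fun _ => ()) {()}
    (by simp) (by simpa using (not_le.1 hw).le)
  have := List.length_pos_iff.2 hv
  exact ih _ (by simp at hn ⊢; omega) hrun rfl

/-- Every cut of an accepted word at a state `r` can be completed on either side: `z` leads from an
initial state to `r`, `z'` leads from `r` to acceptance, and both are short. -/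
lemma Supported.exists_completion (hS : M.Supported S) (hr : r ∈ M.eval u)
    (hr' : v ∈ M.acceptsFrom {r}) :
    ∃ z z', r ∈ M.eval z ∧ z' ∈ M.acceptsFrom {r} ∧ z.length ≤ S.card ∧ z'.length ≤ S.card := by
  obtain ⟨z, hz, hz'⟩ := hS.exists_short_run hS.start hr
  obtain ⟨q, hq, h⟩ := M.mem_acceptsFrom.1 hr'
  obtain ⟨t, ht, ht'⟩ := hS.exists_short_run (I := {r})
    (by simpa using hS.eval u hr) h
  exact ⟨z, t, hz, M.mem_acceptsFrom.2 ⟨q, hq, ht⟩, hz', ht'⟩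

/-- Every factor of an accepted word becomes accepted after a short extension on either side. -/
lemma Supported.exists_completion_infix (hS : M.Supported S) (hw : w ∈ M.accepts)
    (hv : v <:+: w) :
    ∃ z z', z ++ v ++ z' ∈ M.accepts ∧ z.length ≤ S.card ∧ z'.length ≤ S.card := by
  obtain ⟨a, b, rfl⟩ := hv
  rw [List.append_assoc, append_mem_accepts] at hw
  obtain ⟨r, hr, hvb⟩ := hw
  obtain ⟨s, hs, hb⟩ := append_mem_acceptsFrom_singleton.1 hvb
  obtain ⟨z, -, hz, -, hzl, -⟩ := hS.exists_completion hr hvb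
  obtain ⟨-, z', -, hz', -, hzl'⟩ := hS.exists_completion
    (u := a ++ v) (mem_evalFrom_append.2 ⟨r, hr, hs⟩) hb
  refine ⟨z, z', ?_, hzl, hzl'⟩
  rw [List.append_assoc, append_mem_accepts]
  exact ⟨r, hz, append_mem_acceptsFrom_singleton.2 ⟨s, hs, hz'⟩⟩

end NFA

/-! ### Factoring accepted words with a long walk -/

namespace NFA

open Walk

variable {α σ : Type*} {M : NFA α σ} {S : Finset σ} {f : α → ℤ} {w : List α} {N : ℕ}

/-- The accepted words smaller than `w`: those whose walk visits a shorter interval, and the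
shorter ones whose walk visits an interval that is no longer. -/
def Smaller (M : NFA α σ) (f : α → ℤ) (w v : List α) : Prop :=
  v ∈ M.accepts ∧ (ext f v < ext f w ∨ ext f v ≤ ext f w ∧ v.length < w.length)

/-- A word factors if it has the same profile as a product of smaller accepted words. -/
def Factors (M : NFA α σ) (f : α → ℤ) (w : List α) : Prop :=
  ∃ ws : List (List α), (∀ v ∈ ws, M.Smaller f w v) ∧ profile f ws.flatten = profile f w

lemma Factors.of_neg (h : M.Factors (-f) w) : M.Factors f w := by
  obtain ⟨ws, h1, h2⟩ := h
  exact ⟨ws, by simpa only [Smaller, ext_neg] using h1, (profile_neg_eq_iff f).1 h2⟩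

/-- A long word with a short walk repeats a state together with the profile of a prefix. -/
lemma Supported.factors_of_ext_le (hS : M.Supported S) (hN : S.card ≤ N)
    (hw : w ∈ M.accepts) {R : ℕ} (hR : ext f w ≤ R) (hlen : N * (2 * R + 1) ^ 3 ≤ w.length) :
    M.Factors f w := by
  obtain ⟨q, hq, hrun⟩ := M.mem_accepts.1 hw
  let J : Finset ℤ := Finset.Icc (-R) R
  have hJ : J.card = 2 * R + 1 := by simp [J]; omega
  obtain ⟨u, v, t, rfl, hv, h, hp⟩ := hS.exists_shortcut hS.start hrun (profile f) (J ×ˢ J ×ˢ J)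
    (by
      rintro u v rfl
      have h1 := lo_nonpos f u
      have h2 := hi_nonneg f u
      have h3 := lo_le_disp f u
      have h4 := disp_le_hi f u
      simp only [ext, lo_append, hi_append] at hR
      simp only [profile, J, Finset.mem_product, Finset.mem_Icc]
      omega)
    (by
      simp only [Finset.card_product, hJ]
      calc _ = S.card * (2 * R + 1) ^ 3 := by ring
        _ ≤ _ := (Nat.mul_le_mul_right _ hN).trans hlen)
  have hp' := profile_append_congr f hp t
  refine ⟨[u ++ t], ?_, by simpa using hp'⟩
  have hlv := List.length_pos_iff.2 hv
  obtain ⟨h1, h2, -⟩ := (profile_eq_iff f).1 hp'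
  simp only [List.mem_singleton, forall_eq]
  refine ⟨M.mem_accepts.2 ⟨q, hq, h⟩, Or.inr ⟨?_, ?_⟩⟩
  · rw [ext, ext, h1, h2]
  · simp; omega

/-- A factor that climbs by `2 * N + 1`, shortened and completed to an accepted word. -/
lemma Supported.exists_ascending (hS : M.Supported S) (hN : S.card ≤ N)
    (hf : ∀ x, |f x| ≤ 1) (hw : w ∈ M.accepts) {v : List α} (hv : v <:+: w)
    (h : 2 * N + 1 ≤ disp f v) :
    ∃ g ∈ M.accepts, 1 ≤ disp f g ∧ disp f g ≤ 4 * N + 1 ∧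
      -(4 * N + 1) ≤ lo f g ∧ hi f g ≤ 4 * N + 1 := by
  obtain ⟨b, hb, hd, hl, hh⟩ := exists_climb hf (by omega) hv h
  obtain ⟨z, z', hg, hz, hz'⟩ := hS.exists_completion_infix hw hb
  refine ⟨_, hg, ?_⟩
  have h1 := neg_length_le_lo hf z
  have h2 := hi_le_length hf z
  have h3 := lo_le_disp f z
  have h4 := disp_le_hi f z
  have h5 := neg_length_le_lo hf z'
  have h6 := hi_le_length hf z'
  have h7 := lo_le_disp f z'
  have h8 := disp_le_hi f z'
  simp only [disp_append, lo_append, hi_append]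
  omega

/-- The factor `v₀` of `w = w₁ v₀ w₂` may be replaced by `z' e z`, where `e` is a product of
accepted words and `w₁ z'` and `z w₂` are accepted, provided that the displacements agree, that the
walk of `v₀` misses both ends of the interval visited by `w`, and that the walk of `z' e z` does not
leave this interval. -/
lemma factors_of_replace (hf : ∀ x, |f x| ≤ 1) {w₁ v₀ w₂ z z' : List α}
    (es : List (List α)) (hw : w = w₁ ++ v₀ ++ w₂) (h₁ : w₁ ++ z' ∈ M.accepts)
    (h₂ : z ++ w₂ ∈ M.accepts) (hz : z.length ≤ N) (hz' : z'.length ≤ N)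
    (hw₁ : N < w₁.length) (hw₂ : N < w₂.length)
    (hes : ∀ v ∈ es, v ∈ M.accepts ∧ ext f v < ext f w)
    (hdisp : disp f z' + disp f es.flatten + disp f z = disp f v₀)
    (hlo_es : lo f w + 2 * N ≤ disp f w₁ + lo f es.flatten)
    (hlo_end : lo f w + 2 * N ≤ disp f w₁ + disp f v₀)
    (hlo : lo f w < disp f w₁ + lo f v₀)
    (hhi_es : disp f w₁ + hi f es.flatten + 2 * N ≤ hi f w)
    (hhi_end : disp f w₁ + disp f v₀ + 2 * N ≤ hi f w)
    (hhi : disp f w₁ + hi f v₀ < hi f w) : M.Factors f w := by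
  have a1 := neg_length_le_lo hf z
  have a2 := hi_le_length hf z
  have a3 := lo_le_disp f z
  have a4 := disp_le_hi f z
  have b1 := neg_length_le_lo hf z'
  have b2 := hi_le_length hf z'
  have b3 := lo_le_disp f z'
  have b4 := disp_le_hi f z'
  have c1 := lo_nonpos f es.flatten
  have c2 := hi_nonneg f es.flatten
  have d1 := lo_nonpos f w₂
  have d2 := hi_nonneg f w₂
  subst hw
  simp only [lo_append, hi_append, disp_append] at hlo_es hlo_end hlo hhi_es hhi_end hhi
  refine ⟨[w₁ ++ z'] ++ es ++ [z ++ w₂], ?_, ?_⟩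
  · intro v hv
    simp only [List.mem_append, List.mem_singleton] at hv
    rcases hv with (rfl | hv) | rfl
    · refine ⟨h₁, Or.inr ⟨?_, by simp; omega⟩⟩
      simp only [ext, lo_append, hi_append, disp_append]
      omega
    · exact ⟨(hes v hv).1, Or.inl (hes v hv).2⟩
    · refine ⟨h₂, Or.inr ⟨?_, by simp; omega⟩⟩
      simp only [ext, lo_append, hi_append, disp_append]
      omega
  · simp only [List.flatten_append, List.flatten_singleton, profile_eq_iff, lo_append, hi_append,
      disp_append]
    omega

/-- If words of positive and of negative displacement are available, the displacement of any word
`y` can be cancelled by a product of boundedly many words. -/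
lemma exists_cancel {K : ℕ} {g h y : List α} (hg : 1 ≤ disp f g) (hgK : disp f g ≤ K)
    (hh : disp f h ≤ -1) (hhK : -K ≤ disp f h) (hy : |disp f y| ≤ K) :
    ∃ es : List (List α), (∀ v ∈ es, v = g ∨ v = h ∨ v = y) ∧ es.length ≤ 2 * K ∧
      disp f es.flatten = -disp f y := by
  rw [abs_le] at hy
  rcases le_total 0 (disp f y) with h0 | h0
  · refine ⟨List.replicate ((-disp f h).toNat - 1) y ++ List.replicate (disp f y).toNat h, ?_, ?_,
      ?_⟩
    · simp only [List.mem_append, List.mem_replicate]; tauto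
    · simp; omega
    · rw [List.flatten_append, disp_append, disp_flatten_replicate, disp_flatten_replicate,
        Nat.cast_sub (by omega), Int.toNat_of_nonneg (by omega), Int.toNat_of_nonneg h0]
      push_cast; ring
  · refine ⟨List.replicate ((disp f g).toNat - 1) y ++ List.replicate (-disp f y).toNat g, ?_, ?_,
      ?_⟩
    · simp only [List.mem_append, List.mem_replicate]; tauto
    · simp; omega
    · rw [List.flatten_append, disp_append, disp_flatten_replicate, disp_flatten_replicate,
        Nat.cast_sub (by omega), Int.toNat_of_nonneg (by omega), Int.toNat_of_nonneg (by omega)]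
      push_cast; ring

/-- A long walk passes through every level away from the ends of the interval it visits also after
a few initial and before a few final steps. -/
lemma exists_cut (hf : ∀ x, |f x| ≤ 1) {n : ℕ} {c : ℤ} (hlen : 2 * n ≤ w.length)
    (hlo : lo f w + n ≤ c) (hhi : c + n ≤ hi f w) :
    ∃ w₁ w₂, w = w₁ ++ w₂ ∧ n ≤ w₁.length ∧ n ≤ w₂.length ∧ disp f w₁ = c := by
  have hclamp (i : ℕ) (hi : i ≤ w.length) : ∃ i', n ≤ i' ∧ i' ≤ w.length - n ∧
      |disp f (w.take i') - disp f (w.take i)| ≤ n := by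
    rcases lt_or_ge i n with h | h
    · refine ⟨n, le_rfl, by omega, (abs_disp_take_sub_le hf w h.le).trans ?_⟩
      exact_mod_cast Nat.sub_le _ _
    rcases lt_or_ge (w.length - n) i with h' | h'
    · refine ⟨w.length - n, by omega, le_rfl, ?_⟩
      rw [abs_sub_comm]
      refine (abs_disp_take_sub_le hf w h'.le).trans ?_
      omega
    · exact ⟨i, h, h', by simp⟩
  obtain ⟨u, v, huv, hu⟩ := exists_append_disp_eq_lo f w
  obtain ⟨u', v', huv', hu'⟩ := exists_append_disp_eq_hi f w
  obtain ⟨i, hi1, hi2, hi3⟩ := hclamp u.length (by simp [huv])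
  obtain ⟨j, hj1, hj2, hj3⟩ := hclamp u'.length (by simp [huv'])
  have e1 : w.take u.length = u := by simp [huv]
  have e2 : w.take u'.length = u' := by simp [huv']
  rw [e1, abs_le] at hi3
  rw [e2, abs_le] at hj3
  obtain ⟨t, ht1, ht2, ht⟩ : ∃ t, n ≤ t ∧ t ≤ w.length - n ∧ disp f (w.take t) = c := by
    rcases le_total i j with hij | hij
    · obtain ⟨t, h1, h2, h3⟩ := exists_take_disp_eq hf w c hij (by omega)
      exact ⟨t, by omega, by omega, h3⟩
    · obtain ⟨t, h1, h2, h3⟩ := exists_take_disp_eq hf w c hij (by omega)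
      exact ⟨t, by omega, by omega, h3⟩
  exact ⟨w.take t, w.drop t, by simp, by simp; omega, by simp; omega, ht⟩

/-- Accepted words whose long walk both climbs and descends. Cut away from both ends of the
interval visited and complete both parts; the displacement of the completions is cancelled by a
product of short climbs and descents. -/
lemma Supported.factors_of_climb_of_descent (hS : M.Supported S) (hN : S.card ≤ N)
    (hf : ∀ x, |f x| ≤ 1) (hw : w ∈ M.accepts) (hext : 10 * (4 * N + 1) ^ 3 < ext f w)
    (hlen : 2 * N + 2 ≤ w.length)
    (hup : ∃ v, v <:+: w ∧ 2 * N + 1 ≤ disp f v)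
    (hdown : ∃ v, v <:+: w ∧ disp f v ≤ -(2 * N + 1)) : M.Factors f w := by
  obtain ⟨v, hv, hvd⟩ := hup
  obtain ⟨g, hg, hg1, hg2, hg3, hg4⟩ := hS.exists_ascending hN hf hw hv hvd
  obtain ⟨v, hv, hvd⟩ := hdown
  obtain ⟨h, hh, hh1, hh2, hh3, hh4⟩ := hS.exists_ascending (f := -f) hN (by simpa using hf) hw hv
    (by rw [disp_neg]; omega)
  rw [disp_neg] at hh1 hh2
  rw [lo_neg] at hh3
  rw [hi_neg] at hh4
  obtain ⟨K, hK⟩ : ∃ K, K = 4 * N + 1 := ⟨_, rfl⟩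
  have hK2 : K ≤ K ^ 2 := by nlinarith
  have hK3 : K ^ 2 ≤ K ^ 3 := Nat.pow_le_pow_right (by omega) (by omega)
  have hextw := cast_ext f w
  rw [← hK] at hext
  obtain ⟨K2, hK2'⟩ : ∃ K2, K2 = K ^ 2 := ⟨_, rfl⟩
  rw [← hK2'] at hK2 hK3
  -- The cancelling product will have at most `2 * K` factors, each with a walk inside `[-K, K]`, so
  -- it stays within distance `2 * K ^ 2` of the cut; the rest of the margin is for the completions.
  obtain ⟨w₁, w₂, hw12, hl1, hl2, hc⟩ := exists_cut (n := N + 1) (c := lo f w + 4 * K2) hf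
    (by omega) (by push_cast; omega) (by push_cast; omega)
  rw [hw12, append_mem_accepts] at hw
  obtain ⟨r, hr, hr'⟩ := hw
  obtain ⟨z, z', hz, hz', hzl, hzl'⟩ := hS.exists_completion hr hr'
  have a1 := neg_length_le_lo hf z
  have a2 := hi_le_length hf z
  have a3 := lo_le_disp f z
  have a4 := disp_le_hi f z
  have b1 := neg_length_le_lo hf z'
  have b2 := hi_le_length hf z'
  have b3 := lo_le_disp f z'
  have b4 := disp_le_hi f z'
  obtain ⟨es, hes, heslen, hesd⟩ := exists_cancel (f := f) (K := K) (g := g) (h := h)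
    (y := z ++ z') hg1 (by omega) (by omega) (by omega) (by rw [disp_append, abs_le]; omega)
  have hbound : ∀ v ∈ es, v ∈ M.accepts ∧ -(K : ℤ) ≤ lo f v ∧ hi f v ≤ K := by
    intro v hv
    rcases hes v hv with rfl | rfl | rfl
    · exact ⟨hg, by omega, by omega⟩
    · exact ⟨hh, by omega, by omega⟩
    · exact ⟨append_mem_accepts.2 ⟨r, hz, hz'⟩, by rw [lo_append]; omega,
        by rw [hi_append]; omega⟩
  obtain ⟨hes1, hes2⟩ := flatten_bound f es fun v hv => (hbound v hv).2
  have hesK : (es.length : ℤ) * K ≤ 2 * K2 := by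
    have : es.length * K ≤ 2 * K2 := by rw [hK2']; nlinarith
    exact_mod_cast this
  refine factors_of_replace (w₁ := w₁) (v₀ := []) (w₂ := w₂) (z := z) (z' := z') (N := N) hf es
    (by simpa using hw12) (append_mem_accepts.2 ⟨r, hr, hz'⟩) (append_mem_accepts.2 ⟨r, hz, hr'⟩)
    (by omega) (by omega) (by omega) (by omega) (fun v hv => ⟨(hbound v hv).1, ?_⟩)
    ?_ ?_ ?_ ?_ ?_ ?_ ?_
  · have := hbound v hv
    have := cast_ext f v
    omega
  · rw [hesd, disp_append, disp_nil]; ring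
  all_goals (try simp only [disp_nil, lo_nil, hi_nil]); omega

/-- Accepted words with a long walk that never descends far. More than `N` suitable levels are
passed, so two cuts have the same state and differ in height by a multiple of the displacement `p`
of an accepted word `g`. Between them, the walk is replaced by a power of `g`, preceded by a power
of the word `y` made of the two completions, which adjusts the displacement modulo `p`. -/
lemma Supported.factors_of_no_descent (hS : M.Supported S) (hN : S.card ≤ N) (hN1 : 1 ≤ N)
    (hf : ∀ x, |f x| ≤ 1) (hw : w ∈ M.accepts) (hext : 10 * (4 * N + 1) ^ 3 < ext f w)
    (hdown : ∀ v, v <:+: w → -(2 * N + 1) < disp f v) : M.Factors f w := by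
  obtain ⟨K, hK⟩ : ∃ K, K = 4 * N + 1 := ⟨_, rfl⟩
  rw [← hK] at hext
  have hKK : 5 * K ≤ K ^ 2 := by nlinarith
  have hKKK : 5 * K ^ 2 ≤ K ^ 3 := by
    calc 5 * K ^ 2 ≤ K * K ^ 2 := Nat.mul_le_mul_right _ (by omega)
      _ = K ^ 3 := by ring
  obtain ⟨K2, hK2⟩ : ∃ K2, K2 = K ^ 2 := ⟨_, rfl⟩
  obtain ⟨K3, hK3⟩ : ∃ K3, K3 = K ^ 3 := ⟨_, rfl⟩
  rw [← hK2] at hKK hKKK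
  rw [← hK3] at hext hKKK
  have hextw := cast_ext f w
  -- The endpoint of `w` is close to the top of its walk.
  have hlow : ∀ v, v <:+: w → -(2 * N + 1) < lo f v := by
    rintro v hv
    obtain ⟨a, b, rfl, ha⟩ := exists_append_disp_eq_lo f v
    exact ha ▸ hdown a ((List.infix_append' [] a b).trans hv)
  have hhigh : ∀ v, v <:+: w → hi f v < disp f v + (2 * N + 1) := by
    rintro v hv
    obtain ⟨a, b, rfl, ha⟩ := exists_append_disp_eq_hi f v
    have := hdown b ((List.suffix_append a b).isInfix.trans hv)
    rw [← ha, disp_append]; omega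
  have hlw := hlow w List.infix_rfl
  have hhw := hhigh w List.infix_rfl
  have hlw0 := lo_nonpos f w
  have hdw := disp_le_hi f w
  obtain ⟨g, hg, hg1, hg2, hg3, hg4⟩ := hS.exists_ascending hN hf hw List.infix_rfl (by omega)
  obtain ⟨p, hp⟩ : ∃ p : ℕ, disp f g = p := ⟨(disp f g).toNat, by omega⟩
  -- The spacing of the levels exceeds the depth of every descent.
  obtain ⟨l, hl⟩ : ∃ l, l = p * (2 * N + 1) := ⟨_, rfl⟩
  have hl1 : 2 * N + 1 ≤ l := by rw [hl]; exact Nat.le_mul_of_pos_left _ (by omega)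
  have hlK : N * l ≤ K3 := by
    rw [hl, hK3]
    calc N * (p * (2 * N + 1)) ≤ K * (K * K) := by gcongr <;> omega
      _ = K ^ 3 := by ring
  have hcut (i : ℕ) : ∃ t r, i ≤ N → disp f (w.take t) = 3 * K2 + i * l ∧ r ∈ M.eval (w.take t) ∧
      w.drop t ∈ M.acceptsFrom {r} := by
    by_cases hi : i ≤ N
    · have : (i : ℤ) * l ≤ K3 := by exact_mod_cast (Nat.mul_le_mul_right l hi).trans hlK
      have : 0 ≤ (i : ℤ) * l := by positivity
      obtain ⟨t, -, -, ht⟩ := exists_take_disp_eq hf w (3 * K2 + i * l) (Nat.zero_le w.length)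
        (by simp only [List.take_zero, disp_nil, List.take_length]; omega)
      rw [← List.take_append_drop t w, append_mem_accepts] at hw
      obtain ⟨r, hr⟩ := hw
      exact ⟨t, r, fun _ => ⟨ht, hr⟩⟩
    · obtain ⟨q, -, -⟩ := M.mem_accepts.1 hw
      exact ⟨0, q, fun h => absurd h hi⟩
  choose t r htr using hcut
  obtain ⟨i, hiN, j, hjN, hij, heq⟩ := Finset.exists_ne_map_eq_of_card_lt_of_maps_to
    (s := Finset.range (N + 1)) (t := S) (f := r) (by rw [Finset.card_range]; omega)
    (fun i hi => hS.eval _ (htr i (by simpa [Nat.lt_succ_iff] using hi)).2.1)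
  wlog hlt : i < j generalizing i j
  · exact this j hjN i hiN hij.symm heq.symm (by omega)
  simp only [Finset.mem_range, Nat.lt_succ_iff] at hiN hjN
  obtain ⟨hi1, hi2, hi3⟩ := htr i hiN
  obtain ⟨hj1, hj2, hj3⟩ := htr j hjN
  have hjl : (j : ℤ) * l ≤ K3 := by exact_mod_cast (Nat.mul_le_mul_right l hjN).trans hlK
  have hil : 0 ≤ (i : ℤ) * l := by positivity
  have hijl : (j : ℤ) * l - i * l = ((j - i : ℕ) : ℤ) * l := by
    rw [Nat.cast_sub hlt.le]; ring
  have hijl' : (l : ℤ) ≤ ((j - i : ℕ) : ℤ) * l := by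
    exact_mod_cast Nat.le_mul_of_pos_left l (by omega)
  have hsplit {a b : ℕ} (hab : a ≤ b) : w.take a ++ (w.take b).drop a = w.take b := by
    conv_rhs => rw [← List.take_append_drop a (w.take b), List.take_take, min_eq_left hab]
  have hinfix (a b : ℕ) : (w.take b).drop a <:+: w :=
    (List.drop_suffix _ _).isInfix.trans (List.take_prefix _ _).isInfix
  have htt : t i ≤ t j := by
    by_contra hcon
    have h1 := hdown _ (hinfix (t j) (t i))
    have h2 := congrArg (disp f) (hsplit (not_le.1 hcon).le)
    rw [disp_append] at h2
    omega
  obtain ⟨w₁, hw₁⟩ : ∃ w₁, w₁ = w.take (t i) := ⟨_, rfl⟩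
  obtain ⟨w₂, hw₂⟩ : ∃ w₂, w₂ = w.drop (t j) := ⟨_, rfl⟩
  obtain ⟨v₀, hv₀⟩ : ∃ v₀, v₀ = (w.take (t j)).drop (t i) := ⟨_, rfl⟩
  have hv₀w : v₀ <:+: w := hv₀ ▸ hinfix _ _
  have hwsplit : w = w₁ ++ v₀ ++ w₂ := by rw [hw₁, hv₀, hw₂, hsplit htt, List.take_append_drop]
  have hj0 : disp f (w.take (t j)) = disp f w₁ + disp f v₀ := by
    rw [← hsplit htt, disp_append, hw₁, hv₀]
  rw [← heq] at hj2 hj3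
  rw [← hw₁] at hi1 hi2
  rw [← hw₂] at hj3
  obtain ⟨z, z', hz, hz', hzl, hzl'⟩ := hS.exists_completion hi2 hi3
  have a1 := neg_length_le_lo hf z
  have a2 := hi_le_length hf z
  have a3 := lo_le_disp f z
  have a4 := disp_le_hi f z
  have b1 := neg_length_le_lo hf z'
  have b2 := hi_le_length hf z'
  have b3 := lo_le_disp f z'
  have b4 := disp_le_hi f z'
  have hv₀lo := hlow v₀ hv₀w
  have hv₀hi := hhigh v₀ hv₀w
  have hw₁len : 3 * (K2 : ℤ) ≤ w₁.length := by
    have := disp_le_hi f w₁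
    have := hi_le_length hf w₁
    omega
  have hw₂len : 3 * (K2 : ℤ) ≤ w₂.length := by
    have := disp_le_hi f w₂
    have := hi_le_length hf w₂
    have h := congrArg (disp f) hwsplit
    rw [disp_append, disp_append] at h
    omega
  obtain ⟨y, hy⟩ : ∃ y, y = z ++ z' := ⟨_, rfl⟩
  have hyM : y ∈ M.accepts := hy ▸ append_mem_accepts.2 ⟨_, hz, hz'⟩
  have hyd : disp f y = disp f z + disp f z' := by rw [hy, disp_append]
  have hylo : -(K : ℤ) ≤ lo f y := by rw [hy, lo_append]; omega
  have hyhi : hi f y ≤ K := by rw [hy, hi_append]; omega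
  -- The number `c - disp f y` of copies of `g`, where `disp f v₀ = p * c`.
  obtain ⟨c, hc⟩ : ∃ c, c = (j - i) * (2 * N + 1) := ⟨_, rfl⟩
  have hc1 : 2 * N + 1 ≤ c := by rw [hc]; exact Nat.le_mul_of_pos_left _ (by omega)
  have hv₀d : disp f v₀ = p * c := by
    have h1 : ((j - i : ℕ) : ℤ) * l = p * c := by rw [hl, hc]; push_cast; ring
    omega
  obtain ⟨m, hm⟩ : ∃ m : ℕ, (m : ℤ) = c - disp f y := ⟨(c - disp f y).toNat, by omega⟩
  have hpy : (p : ℤ) * disp f y ≤ K2 ∧ -(K2 : ℤ) ≤ p * disp f y := by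
    have h1 : (p : ℤ) ≤ K := by omega
    have h2 : |disp f y| ≤ K := by rw [abs_le]; omega
    have h3 : |(p : ℤ) * disp f y| ≤ K2 := by
      rw [abs_mul, Nat.abs_cast, hK2, pow_two]; push_cast
      exact mul_le_mul h1 h2 (abs_nonneg _) (by positivity)
    exact ⟨(abs_le.1 h3).2, (abs_le.1 h3).1⟩
  have hmg : (m : ℤ) * disp f g = p * c - p * disp f y := by rw [hm, hp]; ring
  have hyp : ((p - 1 : ℕ) : ℤ) * disp f y = p * disp f y - disp f y := by
    rw [Nat.cast_sub (by omega)]; push_cast; ring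
  have h1 := flatten_bound f (c := K) (List.replicate (p - 1) y)
    (fun v hv => by rw [List.eq_of_mem_replicate hv]; exact ⟨hylo, hyhi⟩)
  have h2 := flatten_replicate_bound f m g (by omega)
  have hpK : ((List.replicate (p - 1) y).length : ℤ) * K ≤ K2 := by
    rw [List.length_replicate, hK2, pow_two]; push_cast
    exact mul_le_mul_of_nonneg_right (by omega) (by positivity)
  refine factors_of_replace (w₁ := w₁) (v₀ := v₀) (w₂ := w₂) (z := z) (z' := z') (N := N) hf
    (List.replicate (p - 1) y ++ List.replicate m g) hwsplit
    (append_mem_accepts.2 ⟨_, hi2, hz'⟩) (append_mem_accepts.2 ⟨_, hz, hj3⟩)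
    (by omega) (by omega) (by omega) (by omega) ?_ ?_ ?_ ?_ ?_ ?_ ?_ ?_
  · intro v hv
    have := cast_ext f v
    rcases List.mem_append.1 hv with hv | hv
    · obtain rfl := List.eq_of_mem_replicate hv
      exact ⟨hyM, by omega⟩
    · obtain rfl := List.eq_of_mem_replicate hv
      exact ⟨hg, by omega⟩
  all_goals
    try simp only [List.flatten_append, lo_append, hi_append, disp_append,
      disp_flatten_replicate]
    omega

/-- The length from which on every accepted word of an automaton with `N` states factors. For
`R = 10 * (4 * N + 1) ^ 3`, it bounds the number of pairs of a state and a profile with entries in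
`[-R, R]`. -/
def lengthBound (N : ℕ) : ℕ := N * (2 * (10 * (4 * N + 1) ^ 3) + 1) ^ 3

theorem Supported.factors (hS : M.Supported S) (hN : S.card ≤ N) (hN1 : 1 ≤ N)
    (hf : ∀ x, |f x| ≤ 1) (hw : w ∈ M.accepts) (hlen : lengthBound N ≤ w.length) :
    M.Factors f w := by
  rcases Nat.lt_or_ge (10 * (4 * N + 1) ^ 3) (ext f w) with hext | hext
  swap
  · exact hS.factors_of_ext_le hN hw hext hlen
  by_cases hdown : ∀ v, v <:+: w → -(2 * N + 1) < disp f v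
  · exact hS.factors_of_no_descent hN hN1 hf hw hext hdown
  by_cases hup : ∀ v, v <:+: w → disp f v < 2 * N + 1
  · refine Factors.of_neg (hS.factors_of_no_descent hN hN1 (by simpa using hf) hw
      (by rwa [ext_neg]) fun v hv => ?_)
    rw [disp_neg]
    exact neg_lt_neg (hup v hv)
  push Not at hdown hup
  refine hS.factors_of_climb_of_descent hN hf hw hext (le_trans ?_ hlen) hup hdown
  rw [lengthBound]
  have h1 : 4 * N + 1 ≤ (4 * N + 1) ^ 3 := Nat.le_self_pow (by omega) _
  have h2 : 2 * (10 * (4 * N + 1) ^ 3) + 1 ≤ (2 * (10 * (4 * N + 1) ^ 3) + 1) ^ 3 :=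
    Nat.le_self_pow (by omega) _
  nlinarith

/-- Every accepted word has the profile of a product of short accepted words, so both have the same
image under a homomorphism `θ` that depends on the profile only. -/
theorem Supported.exists_short_factorization (hS : M.Supported S) (hN : S.card ≤ N) (hN1 : 1 ≤ N)
    (hf : ∀ x, |f x| ≤ 1) (hw : w ∈ M.accepts) {X : Type*} [Monoid X] (θ : FreeMonoid α →* X)
    (hθ : ∀ u v : List α, profile f u = profile f v →
      θ (FreeMonoid.ofList u) = θ (FreeMonoid.ofList v)) :
    θ (FreeMonoid.ofList w) ∈ Submonoid.closure
      {x | ∃ v ∈ M.accepts, v.length ≤ lengthBound N ∧ θ (FreeMonoid.ofList v) = x} := by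
  induction hn : toLex (ext f w, w.length) using WellFoundedLT.induction generalizing w with
  | _ n ih =>
  rcases Nat.lt_or_ge (lengthBound N) w.length with hlen | hlen
  · obtain ⟨ws, hws, hp⟩ := hS.factors hN hN1 hf hw hlen.le
    rw [← hθ _ _ hp]
    have hmem : ∀ v ∈ ws, θ (FreeMonoid.ofList v) ∈ Submonoid.closure
        {x | ∃ v ∈ M.accepts, v.length ≤ lengthBound N ∧ θ (FreeMonoid.ofList v) = x} := by
      intro v hv
      obtain ⟨hvM, hlt⟩ := hws v hv
      refine ih _ ?_ hvM rfl
      rw [← hn, Prod.Lex.toLex_lt_toLex]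
      rcases hlt with h | ⟨h, h'⟩
      · exact Or.inl h
      · exact h.lt_or_eq.imp id fun h => ⟨h, h'⟩
    clear hws hp
    induction ws with
    | nil => exact (map_one θ).symm ▸ one_mem _
    | cons v ws ihw =>
      rw [List.flatten_cons, FreeMonoid.ofList_append, map_mul]
      exact mul_mem (hmem v List.mem_cons_self) (ihw fun u hu => hmem u (List.mem_cons_of_mem _ hu))
  · exact Submonoid.subset_closure ⟨w, hw, hlen, rfl⟩

end NFA

/-! ### Words with the same profile represent the same element -/

section CommutingIdempotents

variable {X : Type*} [Monoid X]

/-- Powers of `a` and `b` are mutually inverse, and the resulting idempotents commute. -/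
structure PowersInverse (a b : X) : Prop where
  left (n : ℕ) : a ^ n * b ^ n * a ^ n = a ^ n
  right (n : ℕ) : b ^ n * a ^ n * b ^ n = b ^ n
  comm (m n : ℕ) : a ^ m * b ^ m * (b ^ n * a ^ n) = b ^ n * a ^ n * (a ^ m * b ^ m)
  comm_left (m n : ℕ) : a ^ m * b ^ m * (a ^ n * b ^ n) = a ^ n * b ^ n * (a ^ m * b ^ m)
  comm_right (m n : ℕ) : b ^ m * a ^ m * (b ^ n * a ^ n) = b ^ n * a ^ n * (b ^ m * a ^ m)

namespace PowersInverse

variable {a b : X}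

lemma symm (h : PowersInverse a b) : PowersInverse b a :=
  ⟨h.right, h.left, fun m n => (h.comm n m).symm, h.comm_right, h.comm_left⟩

lemma mul_of_le (h : PowersInverse a b) {m n : ℕ} (hmn : m ≤ n) :
    a ^ n * (b ^ m * a ^ m) = a ^ n := by
  obtain ⟨k, rfl⟩ := Nat.exists_eq_add_of_le' hmn
  rw [pow_add, mul_assoc, ← mul_assoc (a ^ m), h.left]

lemma pow_succ_mul (h : PowersInverse a b) (n : ℕ) :
    b ^ (n + 1) * a = b ^ (n + 1) * a ^ (n + 1) * b ^ n := by
  have h1 := h.comm n 1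
  simp only [pow_one] at h1
  calc b ^ (n + 1) * a = b ^ n * a ^ n * b ^ n * (b * a) := by
        rw [h.right, pow_succ]; simp only [mul_assoc]
    _ = b ^ n * (a ^ n * b ^ n * (b * a)) := by simp only [mul_assoc]
    _ = b ^ (n + 1) * a ^ (n + 1) * b ^ n := by
      rw [h1, pow_succ b, pow_succ' a]; simp only [mul_assoc]

/-- The element whose walk visits `[-m, n]` and ends at `k`. -/
def normalForm (a b : X) (m n : ℕ) (k : ℤ) : X :=
  b ^ m * a ^ m * (a ^ n * b ^ n) * (a ^ k.toNat * b ^ (-k).toNat)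

lemma normalForm_symm (h : PowersInverse a b) (m n : ℕ) (k : ℤ) :
    normalForm b a n m (-k) = normalForm a b m n k := by
  rw [normalForm, normalForm, h.comm, neg_neg]
  rcases le_total 0 k with hk | hk
  · rw [Int.toNat_of_nonpos (by omega : -k ≤ 0)]; simp
  · rw [Int.toNat_of_nonpos hk]; simp

lemma normalForm_mul (h : PowersInverse a b) {m n : ℕ} {k : ℤ} (hm : -m ≤ k) (hn : k ≤ n) :
    normalForm a b m n k * a = normalForm a b m (max n (k + 1).toNat) (k + 1) := by
  rcases lt_or_ge k 0 with hk | hk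
  · obtain ⟨j, rfl⟩ : ∃ j : ℕ, k = -(j + 1 : ℕ) := ⟨(-k).toNat - 1, by omega⟩
    have h1 : (-((j + 1 : ℕ) : ℤ)).toNat = 0 := by omega
    have h2 : (-(-((j + 1 : ℕ) : ℤ))).toNat = j + 1 := by omega
    have h3 : (-((j + 1 : ℕ) : ℤ) + 1).toNat = 0 := by omega
    have h4 : (-(-((j + 1 : ℕ) : ℤ) + 1)).toNat = j := by omega
    rw [normalForm, normalForm, h1, h2, h3, h4, Nat.max_zero, pow_zero, one_mul, one_mul,
      mul_assoc, h.pow_succ_mul, ← h.comm]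
    calc _ = a ^ n * b ^ n * (b ^ m * (a ^ m * (b ^ (j + 1) * a ^ (j + 1)))) * b ^ j := by
          simp only [mul_assoc]
      _ = _ := by rw [h.mul_of_le (by omega)]
  · lift k to ℕ using hk
    have h1 : (-(k : ℤ)).toNat = 0 := by omega
    have h2 : ((k : ℤ) + 1).toNat = k + 1 := by omega
    have h3 : (-((k : ℤ) + 1)).toNat = 0 := by omega
    rw [normalForm, normalForm, h1, h2, h3, Int.toNat_natCast, pow_zero, mul_one, mul_one,
      mul_assoc _ _ a, ← pow_succ]
    rcases Nat.lt_or_ge k n with hkn | hkn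
    · rw [max_eq_left (by omega)]
    · obtain rfl : k = n := by omega
      rw [max_eq_right (by omega), mul_assoc _ (a ^ (k + 1) * b ^ (k + 1)), h.left, pow_succ,
        mul_assoc, ← mul_assoc _ _ a, h.left]

end PowersInverse

end CommutingIdempotents

namespace FreeInverseMonoid

variable {α : Type*}

lemma ofWord_append (u v : List (α × Bool)) : ofWord (u ++ v) = ofWord u * ofWord v := by
  rw [ofWord, FreeMonoid.ofList_append, map_mul]; rfl

lemma mk_eq_of_rel {u v : FreeMonoid (α × Bool)} (h : WagnerRel α u v) :
    (wagnerCon α).mk' u = (wagnerCon α).mk' v :=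
  (Con.eq _).2 (ConGen.Rel.of _ _ h)

lemma wordInv_mul (u v : FreeMonoid (α × Bool)) : wordInv (u * v) = wordInv v * wordInv u := by
  simp [wordInv]

lemma wordInv_pow (u : FreeMonoid (α × Bool)) (n : ℕ) : wordInv (u ^ n) = wordInv u ^ n := by
  induction n with
  | zero => rfl
  | succ n ih => rw [pow_succ, wordInv_mul, ih, pow_succ']

lemma powersInverse (x : α) :
    PowersInverse (ofWord [(x, true)]) (ofWord [(x, false)]) := by
  have h1 : wordInv (FreeMonoid.of (x, true)) = FreeMonoid.of (x, false) := rfl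
  have h2 : wordInv (FreeMonoid.of (x, false)) = FreeMonoid.of (x, true) := rfl
  have reg (y : α × Bool) (n : ℕ) := mk_eq_of_rel (WagnerRel.regular (FreeMonoid.of y ^ n))
  have com (y z : α × Bool) (m n : ℕ) :=
    mk_eq_of_rel (WagnerRel.comm (FreeMonoid.of y ^ m) (FreeMonoid.of z ^ n))
  simp only [wordInv_pow, map_mul, map_pow] at reg com
  have r1 := reg (x, true)
  have r2 := reg (x, false)
  have c1 := com (x, true) (x, false)
  have c2 := com (x, true) (x, true)
  have c3 := com (x, false) (x, false)
  simp only [h1, h2] at r1 r2 c1 c2 c3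
  exact ⟨r1, r2, c1, c2, c3⟩

/-- The sign of a letter. -/
def sign (x : Unit × Bool) : ℤ := if x.2 then 1 else -1

lemma abs_sign_le (x : Unit × Bool) : |sign x| ≤ 1 := by
  unfold sign; split <;> simp

open Walk PowersInverse

lemma ofWord_eq_normalForm (w : List (Unit × Bool)) :
    ofWord w = normalForm (ofWord [((), true)]) (ofWord [((), false)])
      (-lo sign w).toNat (hi sign w).toNat (disp sign w) := by
  have h := powersInverse ()
  induction w using List.reverseRecOn with
  | nil => simp [normalForm]; rfl
  | append_singleton w x ih =>
    have h1 := lo_le_disp sign w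
    have h2 := disp_le_hi sign w
    have h3 := lo_nonpos sign w
    have h4 := hi_nonneg sign w
    rw [ofWord_append, ih, lo_append, hi_append, disp_append]
    obtain ⟨⟨⟩, _ | _⟩ := x
    · simp only [disp, lo, hi, sign]
      rw [← h.normalForm_symm, h.symm.normalForm_mul (by omega) (by omega), ← h.normalForm_symm]
      congr 1 <;> simp <;> omega
    · simp only [disp, lo, hi, sign]
      rw [h.normalForm_mul (by omega) (by omega)]
      congr 1 <;> simp <;> omega

theorem ofWord_eq_of_profile_eq {u v : List (Unit × Bool)}
    (h : profile sign u = profile sign v) : ofWord u = ofWord v := by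
  obtain ⟨h1, h2, h3⟩ := (profile_eq_iff sign).1 h
  rw [ofWord_eq_normalForm u, ofWord_eq_normalForm v, h1, h2, h3]

end FreeInverseMonoid

/-! ### Rational subsets are images of regular languages -/

namespace Language

variable {α : Type*} {L K : Language α}

lemma IsRegular.of_finite (h : (L : Set (List α)).Finite) : L.IsRegular := by
  refine IsRegular.of_finite_range_leftQuotient
    (Set.Finite.subset (s := 𝒫 {v | ∃ w ∈ L, v ∈ w.tails}) (Set.Finite.finite_subsets ?_) ?_)
  · have := h.biUnion (t := fun w => {v | v ∈ w.tails}) fun w _ => w.tails.finite_toSet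
    refine this.subset ?_
    rintro v ⟨w, hw, hv⟩
    exact Set.mem_biUnion hw hv
  · rintro _ ⟨u, rfl⟩ v hv
    exact ⟨u ++ v, hv, by simp⟩

/-- A word of `L * K` that starts with `x` either continues a prefix `x` of a word of `L`, or is a
word of `L` contained in `x` followed by the continuation, to a word of `K`, of the rest of `x`. -/
lemma IsRegular.mul (hL : L.IsRegular) (hK : K.IsRegular) : (L * K).IsRegular := by
  refine IsRegular.of_finite_range_leftQuotient (Set.Finite.subset
    ((hL.finite_range_leftQuotient.prod hK.finite_range_leftQuotient.finite_subsets).image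
      fun p : Language α × Set (Language α) => p.1 * K + sSup p.2) ?_)
  rintro _ ⟨x, rfl⟩
  refine ⟨(L.leftQuotient x, {l | ∃ u ∈ L, ∃ v, x = u ++ v ∧ l = K.leftQuotient v}),
    ⟨⟨x, rfl⟩, ?_⟩, ?_⟩
  · rintro _ ⟨u, -, v, -, rfl⟩
    exact ⟨v, rfl⟩
  · ext y
    have hs : y ∈ sSup {l | ∃ u ∈ L, ∃ v, x = u ++ v ∧ l = K.leftQuotient v} ↔
        ∃ u ∈ L, ∃ v, x = u ++ v ∧ v ++ y ∈ K := by
      constructor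
      · rintro ⟨_, ⟨u, hu, v, hx, rfl⟩, hy⟩
        exact ⟨u, hu, v, hx, hy⟩
      · rintro ⟨u, hu, v, hx, hy⟩
        exact ⟨_, ⟨u, hu, v, hx, rfl⟩, hy⟩
    simp only [mem_add, hs, mem_leftQuotient, mem_mul]
    constructor
    · rintro (⟨c, hc, b, hb, rfl⟩ | ⟨u, hu, v, rfl, hv⟩)
      · exact ⟨x ++ c, hc, b, hb, by simp⟩
      · exact ⟨u, hu, v ++ y, hv, by simp⟩
    · rintro ⟨a, ha, b, hb, hab⟩
      rcases List.append_eq_append_iff.1 hab with ⟨c, rfl, rfl⟩ | ⟨c, rfl, rfl⟩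
      · exact Or.inr ⟨a, ha, c, rfl, hb⟩
      · exact Or.inl ⟨c, ha, b, hb, rfl⟩

/-- A word of `L∗` that starts with `x ≠ []` continues, to a word of `L`, the rest of `x` after an
initial word of `L∗`. -/
lemma IsRegular.kstar (hL : L.IsRegular) : (KStar.kstar L).IsRegular := by
  refine IsRegular.of_finite_range_leftQuotient (Set.Finite.subset
    ((hL.finite_range_leftQuotient.finite_subsets.image
      fun p : Set (Language α) => sSup p * KStar.kstar L).insert (KStar.kstar L)) ?_)
  rintro _ ⟨x, rfl⟩
  rcases eq_or_ne x [] with rfl | hx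
  · exact Or.inl rfl
  refine Or.inr ⟨{l | ∃ u ∈ KStar.kstar L, ∃ v, x = u ++ v ∧ l = L.leftQuotient v}, ?_, ?_⟩
  · rintro _ ⟨u, -, v, -, rfl⟩
    exact ⟨v, rfl⟩
  · ext y
    have hs (y : List α) :
        y ∈ sSup {l | ∃ u ∈ KStar.kstar L, ∃ v, x = u ++ v ∧ l = L.leftQuotient v} ↔
        ∃ u ∈ KStar.kstar L, ∃ v, x = u ++ v ∧ v ++ y ∈ L := by
      constructor
      · rintro ⟨_, ⟨u, hu, v, hx, rfl⟩, hy⟩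
        exact ⟨u, hu, v, hx, hy⟩
      · rintro ⟨u, hu, v, hx, hy⟩
        exact ⟨_, ⟨u, hu, v, hx, rfl⟩, hy⟩
    simp only [mem_leftQuotient, mem_mul, hs]
    constructor
    · rintro ⟨c, ⟨u, hu, v, rfl, hv⟩, d, hd, rfl⟩
      obtain ⟨us, rfl, hus⟩ := mem_kstar.1 hu
      obtain ⟨ds, rfl, hds⟩ := mem_kstar.1 hd
      refine mem_kstar.2 ⟨us ++ [v ++ c] ++ ds, by simp, ?_⟩
      simp only [List.mem_append, List.mem_singleton]
      rintro w ((hw | rfl) | hw)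
      exacts [hus w hw, hv, hds w hw]
    · intro h
      obtain ⟨ws, hws, hL'⟩ := mem_kstar.1 h
      rcases List.flatten_eq_append_iff.1 hws.symm with
        ⟨as, bs, rfl, rfl, rfl⟩ | ⟨as, b, c, cs, ds, rfl, rfl, rfl⟩
      · rcases List.eq_nil_or_concat as with rfl | ⟨as, a, rfl⟩
        · simp at hx
        · refine ⟨[], ⟨as.flatten, join_mem_kstar fun w hw => hL' w (by simp [hw]), a, by simp,
            hL' _ (by simp)⟩, bs.flatten, join_mem_kstar fun w hw => hL' w (by simp [hw]), rfl⟩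
      · exact ⟨c :: cs, ⟨as.flatten, join_mem_kstar fun w hw => hL' w (by simp [hw]), b, rfl,
          hL' _ (by simp)⟩, ds.flatten, join_mem_kstar fun w hw => hL' w (by simp [hw]), by simp⟩

end Language

namespace FreeInverseMonoid

variable {α : Type*}

lemma ofWord_surjective : Function.Surjective (ofWord : List (α × Bool) → FreeInverseMonoid α) :=
  fun x => (Con.mk'_surjective x).imp fun _ h => h

lemma image_ofWord_mul (L K : Language (α × Bool)) :
    ofWord '' (L * K : Language (α × Bool)) = (ofWord '' L) * (ofWord '' K) := by
  ext x
  constructor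
  · rintro ⟨_, hw, rfl⟩
    obtain ⟨u, hu, v, hv, rfl⟩ := Language.mem_mul.1 hw
    exact ⟨_, ⟨u, hu, rfl⟩, _, ⟨v, hv, rfl⟩, (ofWord_append u v).symm⟩
  · rintro ⟨_, ⟨u, hu, rfl⟩, _, ⟨v, hv, rfl⟩, rfl⟩
    exact ⟨u ++ v, Language.append_mem_mul hu hv, ofWord_append u v⟩

lemma image_ofWord_pow (L : Language (α × Bool)) (n : ℕ) :
    ofWord '' (L ^ n : Language (α × Bool)) = (ofWord '' L) ^ n := by
  induction n with
  | zero =>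
    rw [pow_zero, pow_zero, Language.one_def]
    exact Set.image_singleton
  | succ n ih => rw [pow_succ, image_ofWord_mul, ih, pow_succ]

theorem exists_isRegular_image_eq {s : Set (FreeInverseMonoid α)} (h : IsRationalSubset s) :
    ∃ L : Language (α × Bool), L.IsRegular ∧ ofWord '' (L : Set (List (α × Bool))) = s := by
  induction h with
  | finite s hs =>
    refine ⟨(Function.surjInv ofWord_surjective '' s : Set (List (α × Bool))),
      .of_finite (hs.image _), ?_⟩
    rw [Set.image_image]
    simp [Function.surjInv_eq]
  | union s t _ _ ihs iht =>
    obtain ⟨L, hL, rfl⟩ := ihs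
    obtain ⟨K, hK, rfl⟩ := iht
    exact ⟨L + K, hL.add hK, Set.image_union _ _ _⟩
  | mul s t _ _ ihs iht =>
    obtain ⟨L, hL, rfl⟩ := ihs
    obtain ⟨K, hK, rfl⟩ := iht
    exact ⟨L * K, hL.mul hK, image_ofWord_mul L K⟩
  | star s _ ihs =>
    obtain ⟨L, hL, rfl⟩ := ihs
    refine ⟨KStar.kstar L, hL.kstar, ?_⟩
    ext x
    constructor
    · rintro ⟨w, hw, rfl⟩
      obtain ⟨n, hn⟩ := Language.mem_iSup.1 ((Language.kstar_eq_iSup_pow L).le hw)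
      exact Set.mem_iUnion.2 ⟨n, (image_ofWord_pow L n).le ⟨w, hn, rfl⟩⟩
    · intro hx
      obtain ⟨n, hn⟩ := Set.mem_iUnion.1 hx
      obtain ⟨w, hw, rfl⟩ := (image_ofWord_pow L n).ge hn
      exact ⟨w, (Language.kstar_eq_iSup_pow L).ge (Language.mem_iSup.2 ⟨n, hw⟩), rfl⟩

end FreeInverseMonoid

/-! ### Computing the generators -/

namespace FiniteAutomaton

variable {α : Type*} (A : FiniteAutomaton α)

/-- An upper bound, at least `1`, for the number of states that a run can reach. -/
def numStates : ℕ := A.1.length + A.2.2.length + 1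

/-- The pairs of a word of length `n` and a state in which some run reading it ends. -/
def runs : ℕ → List (ℕ × List (α × Bool))
  | 0 => A.1.map fun q => (q, [])
  | n + 1 => (runs n).flatMap fun c => A.2.2.filterMap fun e =>
      if e.1 = c.1 then some (e.2.2, c.2 ++ [e.2.1]) else none

/-- The accepted words of length at most `B`. -/
def shortWords (B : ℕ) : List (List (α × Bool)) :=
  (List.range (B + 1)).flatMap fun n => (A.runs n).flatMap fun c => A.2.1.filterMap fun q =>
    if q = c.1 then some c.2 else none

lemma mem_runs {n : ℕ} {q : ℕ} {w : List (α × Bool)} :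
    (q, w) ∈ A.runs n ↔ w.length = n ∧ q ∈ A.toNFA.eval w := by
  induction n generalizing q w with
  | zero =>
    simp only [runs, List.mem_map, Prod.mk.injEq, List.length_eq_zero_iff]
    constructor
    · rintro ⟨p, hp, rfl, rfl⟩
      exact ⟨rfl, hp⟩
    · rintro ⟨rfl, hq⟩
      exact ⟨q, hq, rfl, rfl⟩
  | succ n ih =>
    simp only [runs, List.mem_flatMap, List.mem_filterMap, Option.ite_none_right_eq_some,
      Option.some.injEq, Prod.mk.injEq, Prod.exists]
    constructor
    · rintro ⟨p, u, hu, p', x, b, q', he, rfl, rfl, rfl⟩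
      obtain ⟨rfl, hp⟩ := ih.1 hu
      refine ⟨by simp, ?_⟩
      rw [NFA.eval_append_singleton, NFA.mem_stepSet]
      exact ⟨_, hp, he⟩
    · rintro ⟨hl, hq⟩
      rcases List.eq_nil_or_concat w with rfl | ⟨u, x, rfl⟩
      · simp at hl
      rw [List.concat_eq_append] at hl hq ⊢
      rw [NFA.eval_append_singleton, NFA.mem_stepSet] at hq
      obtain ⟨p, hp, he⟩ := hq
      exact ⟨p, u, ih.2 ⟨by simpa using hl, hp⟩, p, x.1, x.2, q, he, rfl, rfl, rfl⟩

lemma mem_shortWords {B : ℕ} {w : List (α × Bool)} :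
    w ∈ A.shortWords B ↔ w ∈ A.toNFA.accepts ∧ w.length ≤ B := by
  simp only [shortWords, List.mem_flatMap, List.mem_range, List.mem_filterMap,
    Option.ite_none_right_eq_some, Option.some.injEq, Prod.exists, Nat.lt_succ_iff]
  constructor
  · rintro ⟨n, hn, q, u, hu, q', hq', rfl, rfl⟩
    obtain ⟨rfl, hq⟩ := A.mem_runs.1 hu
    exact ⟨⟨_, hq', hq⟩, hn⟩
  · rintro ⟨⟨q, hq, hw⟩, hl⟩
    exact ⟨_, hl, q, w, A.mem_runs.2 ⟨rfl, hw⟩, q, hq, rfl, rfl⟩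

/-- The states in which a run can be. -/
def support : Finset ℕ := (A.1 ++ A.2.2.map fun e => e.2.2).toFinset

lemma card_support_le : A.support.card ≤ A.numStates :=
  (List.toFinset_card_le _).trans (by simp [numStates])

lemma supported : A.toNFA.Supported A.support where
  start q hq := by
    have : q ∈ A.1 := hq
    simp [support, this]
  step p x q hq := by
    have : (p, x, q) ∈ A.2.2 := hq
    simp only [support, Finset.mem_coe, List.mem_toFinset, List.mem_append, List.mem_map]
    exact Or.inr ⟨_, this, rfl⟩

section Primrec

variable [Primcodable α]

lemma primrec_runs : Primrec₂ fun (A : FiniteAutomaton α) (n : ℕ) => A.runs n := by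
  have hedge : Primrec fun p : ((FiniteAutomaton α × ℕ × List (ℕ × List (α × Bool))) ×
      (ℕ × List (α × Bool))) × (ℕ × (α × Bool) × ℕ) =>
      if p.2.1 = p.1.2.1 then some (p.2.2.2, p.1.2.2 ++ [p.2.2.1]) else none := by
    refine Primrec.ite (Primrec.eq.comp (Primrec.fst.comp Primrec.snd)
      (Primrec.fst.comp (Primrec.snd.comp Primrec.fst))) (Primrec.option_some.comp ?_)
      (Primrec.const none)
    exact Primrec.pair (Primrec.snd.comp (Primrec.snd.comp Primrec.snd))
      (Primrec.list_concat.comp (Primrec.snd.comp (Primrec.snd.comp Primrec.fst))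
        (Primrec.fst.comp (Primrec.snd.comp Primrec.snd)))
  have hstep : Primrec₂ fun (A : FiniteAutomaton α) (p : ℕ × List (ℕ × List (α × Bool))) =>
      p.2.flatMap fun c => A.2.2.filterMap fun e =>
        if e.1 = c.1 then some (e.2.2, c.2 ++ [e.2.1]) else none :=
    Primrec.list_flatMap (Primrec.snd.comp Primrec.snd)
      (Primrec.listFilterMap
        (Primrec.snd.comp (Primrec.snd.comp (Primrec.fst.comp Primrec.fst))) hedge.to₂).to₂
  refine (Primrec.nat_rec (f := fun A : FiniteAutomaton α => A.1.map fun q => (q, []))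
    (Primrec.list_map Primrec.fst (Primrec.pair Primrec.snd (Primrec.const [])).to₂) hstep).of_eq ?_
  intro A n
  induction n with
  | zero => rfl
  | succ n ih => simp only [runs] at ih ⊢; rw [← ih]

lemma primrec_shortWords : Primrec₂ fun (A : FiniteAutomaton α) (B : ℕ) => A.shortWords B := by
  have haccept : Primrec fun p : (((FiniteAutomaton α × ℕ) × ℕ) × (ℕ × List (α × Bool))) × ℕ =>
      if p.2 = p.1.2.1 then some p.1.2.2 else none :=
    Primrec.ite (Primrec.eq.comp Primrec.snd (Primrec.fst.comp (Primrec.snd.comp Primrec.fst)))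
      (Primrec.option_some.comp (Primrec.snd.comp (Primrec.snd.comp Primrec.fst)))
      (Primrec.const none)
  refine Primrec.list_flatMap (Primrec.list_range.comp (Primrec.succ.comp Primrec.snd)) ?_
  refine Primrec.list_flatMap (primrec_runs.comp (Primrec.fst.comp Primrec.fst) Primrec.snd) ?_
  exact (Primrec.listFilterMap (Primrec.fst.comp (Primrec.snd.comp
    (Primrec.fst.comp (Primrec.fst.comp Primrec.fst)))) haccept.to₂).to₂

lemma primrec_numStates : Primrec fun A : FiniteAutomaton α => A.numStates :=
  Primrec.succ.comp (Primrec.nat_add.comp (Primrec.list_length.comp Primrec.fst)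
    (Primrec.list_length.comp (Primrec.snd.comp Primrec.snd)))

end Primrec

end FiniteAutomaton

lemma primrec_pow_three : Primrec fun n : ℕ => n ^ 3 :=
  (Primrec.nat_mul.comp (Primrec.nat_mul.comp .id .id) .id).of_eq fun n => by
    simp only [id]; ring

lemma primrec_lengthBound : Primrec NFA.lengthBound := by
  have h : Primrec fun N : ℕ => (4 * N + 1) ^ 3 := primrec_pow_three.comp
    (Primrec.succ.comp (Primrec.nat_mul.comp (.const 4) .id))
  exact Primrec.nat_mul.comp .id (primrec_pow_three.comp (Primrec.succ.comp
    (Primrec.nat_mul.comp (.const 2) (Primrec.nat_mul.comp (.const 10) h))))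

/-! ### Rational submonoids -/

namespace FreeInverseMonoid

/-- The image of the language of an automaton lies in the submonoid generated by the images of the
short accepted words. -/
theorem closure_short_eq {σ : Type*} {A : NFA (Unit × Bool) σ} {S : Finset σ} {N : ℕ}
    (hS : A.Supported S) (hN : S.card ≤ N) (hN1 : 1 ≤ N) {M : Submonoid MonogenicFIM}
    (h : ofWord '' (A.accepts : Set (List (Unit × Bool))) = (M : Set MonogenicFIM)) :
    Submonoid.closure {x | ∃ w ∈ A.accepts, w.length ≤ NFA.lengthBound N ∧ ofWord w = x} = M := by
  apply le_antisymm
  · rw [Submonoid.closure_le, ← h]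
    rintro _ ⟨w, hw, -, rfl⟩
    exact ⟨w, hw, rfl⟩
  · intro x hx
    rw [← SetLike.mem_coe, ← h] at hx
    obtain ⟨w, hw, rfl⟩ := hx
    exact hS.exists_short_factorization hN hN1 abs_sign_le hw (wagnerCon Unit).mk'
      fun u v => ofWord_eq_of_profile_eq

end FreeInverseMonoid

lemma Submonoid.coe_closure_eq_iUnion_pow {X : Type*} [Monoid X] (s : Set X) :
    (Submonoid.closure s : Set X) = ⋃ n : ℕ, s ^ n := by
  apply Set.Subset.antisymm
  · intro x hx
    induction hx using Submonoid.closure_induction with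
    | mem x hx => exact Set.mem_iUnion.2 ⟨1, by rwa [pow_one]⟩
    | one => exact Set.mem_iUnion.2 ⟨0, by rw [pow_zero]; rfl⟩
    | mul x y _ _ hx hy =>
      obtain ⟨m, hm⟩ := Set.mem_iUnion.1 hx
      obtain ⟨n, hn⟩ := Set.mem_iUnion.1 hy
      exact Set.mem_iUnion.2 ⟨m + n, by rw [pow_add]; exact Set.mul_mem_mul hm hn⟩
  · refine Set.iUnion_subset fun n => ?_
    induction n with
    | zero => simp
    | succ n ih =>
      rw [pow_succ]
      rintro _ ⟨x, hx, y, hy, rfl⟩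
      exact mul_mem (ih hx) (Submonoid.subset_closure hy)

theorem mainTheorem2 :
    (∀ M : Submonoid MonogenicFIM, IsRationalSubset (M : Set MonogenicFIM) ↔ M.FG) ∧
    ∃ gens : FiniteAutomaton Unit → List (List (Unit × Bool)), Computable gens ∧
      ∀ (A : FiniteAutomaton Unit) (M : Submonoid MonogenicFIM),
        FiniteAutomaton.subset A = (M : Set MonogenicFIM) →
          Submonoid.closure {x | ∃ w ∈ gens A, FreeInverseMonoid.ofWord w = x} = M := by
  refine ⟨fun M => ⟨fun h => ?_, fun h => ?_⟩,
    fun A => A.shortWords (NFA.lengthBound A.numStates), ?_, fun A M h => ?_⟩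
  · obtain ⟨L, ⟨σ, _, D, rfl⟩, hL⟩ := FreeInverseMonoid.exists_isRegular_image_eq h
    rw [← D.toNFA_correct] at hL
    have hS : D.toNFA.Supported Finset.univ := ⟨by simp, by simp⟩
    rw [Submonoid.fg_iff]
    refine ⟨_, FreeInverseMonoid.closure_short_eq hS (Nat.le_succ _) (by omega) hL, ?_⟩
    have hfin := List.finite_length_le (Unit × Bool)
      (NFA.lengthBound (Finset.univ : Finset σ).card.succ)
    refine (hfin.image FreeInverseMonoid.ofWord).subset ?_
    rintro _ ⟨w, -, hw, rfl⟩
    exact ⟨w, hw, rfl⟩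
  · obtain ⟨s, rfl, hs⟩ := (Submonoid.fg_iff M).1 h
    rw [Submonoid.coe_closure_eq_iUnion_pow]
    exact .star s (.finite s hs)
  · exact (FiniteAutomaton.primrec_shortWords.comp .id
      (primrec_lengthBound.comp FiniteAutomaton.primrec_numStates)).to_comp
  · simpa only [FiniteAutomaton.mem_shortWords, and_assoc] using
      FreeInverseMonoid.closure_short_eq A.supported A.card_support_le (by
        simp [FiniteAutomaton.numStates]) h
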